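/- **Conventions.** All spaces are diffeological spaces; subsets, products, quotients carry the subspace, product and quotient diffeologies. A smooth path in $Y$ is a smooth map $\alpha : \operatorname{dom}(\alpha) \to Y$ on an open interval $\operatorname{dom}(\alpha)\subseteq\mathbb R$. The set $\mathcal P Y$ of smooth paths carries the functional diffeology: $r \mapsto \psi_r$ is a plot iff for all $r_0$ and $s_0 \in \operatorname{dom}(\psi_{r_0})$ there are open neighbourhoods $V$ of $r_0$ and $W \subseteq \operatorname{dom}(\psi_{r_0})$ of $s_0$ such that $W \subseteq \operatorname{dom}(\psi_r)$ for all $r \in V$ and $(r,s) \mapsto \psi_r(s)$ is smooth on $V\times W$. Let $\hat{\mathcal P}Y = \{(\alpha,t) \in \mathcal PY\times\mathbb R : t \in \operatorname{dom}(\alpha)\}$. The space $Y$ is path-connected if any two of its points lie in the image of a common smooth path. Let $G$ be a diffeological group (multiplication and inversion are smooth) acting on $E$ from the right such that $\Gamma : E\times G\to E\times E$, $(\xi,g)\mapsto(\xi,\xi g)$, is smooth. A smooth surjection $\pi : E\to X$ is a *diffeological principal $G$-bundle* if $\Gamma$ is a diffeomorphism onto its image and there is a diffeomorphism $\Phi :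 X\to E/G$ with $\Phi(\pi(\xi)) = \xi G$ for all $\xi$. A *connection* on it is a smooth map $A : \hat{\mathcal P}E\to\mathcal PE$, $(\tilde\alpha,t)\mapsto A_t\tilde\alpha$, such that 1. $\operatorname{dom}(A_t\tilde\alpha) = \operatorname{dom}(\tilde\alpha)$; 2. $\pi\circ A_t\tilde\alpha = \pi\circ\tilde\alpha$; 3. $(A_t\tilde\alpha)(t) = \tilde\alpha(t)$; 4. $A_t(\tilde\alpha\cdot\rho) = A_t\tilde\alpha\cdot\rho(t)$ for every smooth $\rho : \operatorname{dom}(\tilde\alpha)\to G$; 5. $A_t(\tilde\alpha\circ f) = (A_{f(t)}\tilde\alpha)\circ f$ for every smooth path $f$ in $\operatorname{dom}(\tilde\alpha)$ and $t\in\operatorname{dom}(f)$; 6. $A_s(A_t\tilde\alpha) = A_t\tilde\alpha$ for all $s,t\in\operatorname{dom}(\tilde\alpha)$. A path $\beta \in \mathcal P E$ is $A$-horizontal if $A_t\beta = \beta$ for some $t \in \operatorname{dom}(\beta)$. For $x_0\in X$ and $\xi\in\pi^{-1}(x_0)$, the *holonomy representation* $H^A_\xi$ assigns to each smooth loop $\gamma$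 at $x_0$ (a smooth path in $X$ with $0,1\in\operatorname{dom}(\gamma)$ and $\gamma(0)=\gamma(1)=x_0$) the element $H^A_\xi(\gamma)\in G$ with $\beta(1) = \xi\cdot H^A_\xi(\gamma)$, where $\beta$ is the unique $A$-horizontal path with $\operatorname{dom}(\beta)=\operatorname{dom}(\gamma)$, $\pi\circ\beta=\gamma$ and $\beta(0)=\xi$. **Corollary.** Let $X$ be a path-connected diffeological space, $x_0\in X$, and $G$ a diffeological group. Let $\pi : E\to X$ and $\pi' : E'\to X$ be diffeological principal $G$-bundles with connections $A$ and $A'$. Suppose that there are points $\xi\in\pi^{-1}(x_0)$ and $\xi'\in(\pi')^{-1}(x_0)$ and an element $g\in G$ such that $$H^A_\xi(\gamma) = g\,H^{A'}_{\xi'}(\gamma)\,g^{-1}\quad\text{for all smooth loops }\gamma\text{ at }x_0.$$ Then there is an isomorphism of $G$-bundles $\Psi : E\to E'$ over $X$ (a $G$-equivariant diffeomorphism with $\pi'\circ\Psi=\pi$) such that $$\Psi\circ A_r\tilde\alpha = A'_r(\Psi\circ\tilde\alpha)\quad\text{for all }(\tilde\alpha,r)\in\hat{\mathcal P}E.$$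 -/

import Mathlib

open scoped ContDiff RightActions
open Diffeology

noncomputable section

namespace DiffeologicalBundles

/-! ## Basic constructions of diffeological spaces -/

section Constructions

variable {X Y Z : Type*} [DiffeologicalSpace X] [DiffeologicalSpace Y] [DiffeologicalSpace Z]

/-- The subspace diffeology: a parametrization of a subspace is a plot if and only if it is a plot
of the ambient space. -/
instance instSubtype (p : X → Prop) : DiffeologicalSpace (Subtype p) where
  plots n := {f | IsPlot (fun r => (f r : X))}
  constant_plots x := isPlot_const (x := (x : X))
  plot_reparam hp hf := isPlot_reparam hp hf
  locality hp := DiffeologicalSpace.locality fun x => by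
    obtain ⟨u, hu, hxu, h⟩ := hp x
    exact ⟨u, hu, hxu, fun hfu hf => h hfu hf⟩

/-- The product diffeology: a parametrization is a plot if and only if both components are. -/
instance instProd : DiffeologicalSpace (X × Y) where
  plots n := {f | IsPlot (fun r => (f r).1) ∧ IsPlot (fun r => (f r).2)}
  constant_plots x := ⟨isPlot_const, isPlot_const⟩
  plot_reparam hp hf := ⟨isPlot_reparam hp.1 hf, isPlot_reparam hp.2 hf⟩
  locality hp := by
    constructor
    · refine DiffeologicalSpace.locality fun x => ?_
      obtain ⟨u, hu, hxu, h⟩ := hp x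
      exact ⟨u, hu, hxu, fun hfu hf => (h hfu hf).1⟩
    · refine DiffeologicalSpace.locality fun x => ?_
      obtain ⟨u, hu, hxu, h⟩ := hp x
      exact ⟨u, hu, hxu, fun hfu hf => (h hfu hf).2⟩

theorem dSmooth_val {p : X → Prop} : DSmooth (Subtype.val : Subtype p → X) := fun _ _ h => h

theorem dSmooth_subtype_mk {p : X → Prop} {f : Y → X} (hf : DSmooth f) (h : ∀ y, p (f y)) :
    DSmooth (fun y => (⟨f y, h y⟩ : Subtype p)) := fun _ _ hq => hf _ _ hq

theorem dSmooth_fst : DSmooth (Prod.fst : X × Y → X) := fun _ _ h => h.1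

theorem dSmooth_snd : DSmooth (Prod.snd : X × Y → Y) := fun _ _ h => h.2

theorem dSmooth_prodMk {f : Z → X} {g : Z → Y} (hf : DSmooth f) (hg : DSmooth g) :
    DSmooth (fun z => (f z, g z)) := fun _ _ h => ⟨hf _ _ h, hg _ _ h⟩

/-- Around every point of an open set of `ℝⁿ` there is a smooth open embedding of `ℝⁿ` into that
set, with smooth inverse on its image. -/
theorem exists_chart {n : ℕ} {u : Set (EuclideanSpace ℝ (Fin n))} (hu : IsOpen u)
    {x : EuclideanSpace ℝ (Fin n)} (hx : x ∈ u) :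
    ∃ (f g : EuclideanSpace ℝ (Fin n) → EuclideanSpace ℝ (Fin n))
      (b : Set (EuclideanSpace ℝ (Fin n))), IsOpen b ∧ x ∈ b ∧ ContDiff ℝ ∞ f ∧
      ContDiffOn ℝ ∞ g b ∧ (∀ y, f y ∈ u) ∧ ∀ y ∈ b, f (g y) = y := by
  obtain ⟨ε, hε, hsub⟩ := Metric.isOpen_iff.mp hu x hx
  refine ⟨OpenPartialHomeomorph.univBall x ε, (OpenPartialHomeomorph.univBall x ε).symm,
    Metric.ball x ε, Metric.isOpen_ball, Metric.mem_ball_self hε,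
    OpenPartialHomeomorph.contDiff_univBall, OpenPartialHomeomorph.contDiffOn_univBall_symm,
    fun y => hsub ?_, fun y hy => ?_⟩
  · have h := (OpenPartialHomeomorph.univBall x ε).map_source (x := y) (by simp)
    rwa [OpenPartialHomeomorph.univBall_target x hε] at h
  · exact (OpenPartialHomeomorph.univBall x ε).right_inv
      (by rwa [OpenPartialHomeomorph.univBall_target x hε])

/-- Maps on open sets of `ℝⁿ` that are smooth in the usual sense are smooth for the subspace
diffeology. -/
theorem dSmooth_of_contDiffOn {n m : ℕ} {u : Set (EuclideanSpace ℝ (Fin n))} (hu : IsOpen u)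
    {g : EuclideanSpace ℝ (Fin n) → EuclideanSpace ℝ (Fin m)} (hg : ContDiffOn ℝ ∞ g u) :
    DSmooth (fun y : u => g y) := by
  intro k q hq
  have hq' : ContDiff ℝ ∞ (fun r => (q r : EuclideanSpace ℝ (Fin n))) :=
    isPlot_iff_contDiff.1 hq
  refine isPlot_iff_contDiff.2 (contDiff_iff_contDiffAt.2 fun r => ?_)
  exact ContDiffAt.comp (g := g) (f := fun r => (q r : EuclideanSpace ℝ (Fin n))) r
    ((hg _ (q r).2).contDiffAt (hu.mem_nhds (q r).2)) hq'.contDiffAt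

/-- The quotient diffeology: plots are the parametrizations that lift locally to plots. The local
lifts are defined on open neighbourhoods `V`, with the subspace diffeology. -/
instance instQuotient (s : Setoid X) : DiffeologicalSpace (Quotient s) where
  plots n := {f | ∀ r₀, ∃ V : Set (EuclideanSpace ℝ (Fin n)), IsOpen V ∧ r₀ ∈ V ∧
    ∃ q : V → X, DSmooth q ∧ ∀ r : V, f r = Quotient.mk s (q r)}
  constant_plots {n} x r₀ := by
    obtain ⟨y, rfl⟩ := Quotient.exists_rep x
    exact ⟨Set.univ, isOpen_univ, trivial, fun _ => y, dSmooth_const, fun _ => rfl⟩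
  plot_reparam {n m p f} hp hf r₀ := by
    obtain ⟨V, hV, hr, q, hq, h⟩ := hp (f r₀)
    refine ⟨f ⁻¹' V, hV.preimage hf.continuous, hr, fun r => q ⟨f r, r.2⟩, ?_, fun r => h ⟨f r, r.2⟩⟩
    exact hq.comp (dSmooth_subtype_mk (hf.dSmooth.comp dSmooth_val) _)
  locality {n p} hp r₀ := by
    obtain ⟨u, hu, hxu, h⟩ := hp r₀
    obtain ⟨f, g, b, hb, hxb, hf, hg, hfu, hfg⟩ := exists_chart hu hxu
    obtain ⟨V, hV, hr, q, hq, hpq⟩ := h hfu hf (g r₀)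
    refine ⟨b ∩ g ⁻¹' V, hg.continuousOn.isOpen_inter_preimage hb hV, ⟨hxb, hr⟩,
      fun r => q ⟨g r, r.2.2⟩, ?_, fun r => ?_⟩
    · exact hq.comp (dSmooth_subtype_mk (dSmooth_of_contDiffOn
        (hg.continuousOn.isOpen_inter_preimage hb hV) (hg.mono Set.inter_subset_left)) _)
    · rw [← hpq ⟨g r, r.2.2⟩, Function.comp_apply, hfg _ r.2.1]

/-- Diffeomorphisms: smooth maps with a smooth inverse. -/
def IsDiffeomorphism (f : X → Y) : Prop :=
  DSmooth f ∧ ∃ g : Y → X, DSmooth g ∧ Function.LeftInverse g f ∧ Function.RightInverse g f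

end Constructions

/-! ## Path spaces -/

section Paths

/-- Smooth paths in `Y`: smooth maps `I → Y` on an open interval `I ⊆ ℝ`. -/
structure SmoothPath (Y : Type*) [DiffeologicalSpace Y] where
  /-- The domain of the path. -/
  dom : Set ℝ
  isOpen_dom : IsOpen dom
  ordConnected_dom : dom.OrdConnected
  /-- The underlying map. -/
  toFun : dom → Y
  smooth : DSmooth toFun

variable {Y Z : Type*} [DiffeologicalSpace Y] [DiffeologicalSpace Z]

/-- The functional diffeology of the path space: `r ↦ ψ r` is a plot if and only if for every `r₀`
and every `s₀ ∈ dom (ψ r₀)` there are open neighbourhoods `V` of `r₀` and `W ⊆ dom (ψ r₀)` of `s₀`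
with `W ⊆ dom (ψ r)` for all `r ∈ V`, such that `(r, s) ↦ ψ r s` is smooth on `V × W`. -/
instance instSmoothPath : DiffeologicalSpace (SmoothPath Y) where
  plots n := {ψ | ∀ r₀, ∀ s₀ ∈ (ψ r₀).dom, ∃ (V : Set (EuclideanSpace ℝ (Fin n))) (W : Set ℝ),
    IsOpen V ∧ IsOpen W ∧ r₀ ∈ V ∧ s₀ ∈ W ∧ ∃ h : ∀ r ∈ V, W ⊆ (ψ r).dom,
      DSmooth (fun x : V × W => (ψ x.1).toFun ⟨x.2, h x.1 x.1.2 x.2.2⟩)}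
  constant_plots {n} α r₀ s₀ hs₀ := by
    refine ⟨Set.univ, α.dom, isOpen_univ, α.isOpen_dom, trivial, hs₀, fun _ _ => subset_rfl, ?_⟩
    exact α.smooth.comp dSmooth_snd
  plot_reparam {n m ψ f} hψ hf r₀ s₀ hs₀ := by
    obtain ⟨V, W, hV, hW, hr, hs, h, hsm⟩ := hψ (f r₀) s₀ hs₀
    refine ⟨f ⁻¹' V, W, hV.preimage hf.continuous, hW, hr, hs, fun r hr => h (f r) hr, ?_⟩
    exact hsm.comp (dSmooth_prodMk (dSmooth_subtype_mk
      (hf.dSmooth.comp (dSmooth_val.comp dSmooth_fst)) fun x => x.1.2) dSmooth_snd)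
  locality {n ψ} hψ r₀ s₀ hs₀ := by
    obtain ⟨u, hu, hxu, hloc⟩ := hψ r₀
    obtain ⟨f, g, b, hb, hxb, hf, hg, hfu, hfg⟩ := exists_chart hu hxu
    have key : ∀ r ∈ b, (ψ ∘ f) (g r) = ψ r := fun r hr => by
      rw [Function.comp_apply, hfg r hr]
    obtain ⟨V, W, hV, hW, hr, hs, h, hsm⟩ := hloc hfu hf (g r₀) s₀ (by rwa [key r₀ hxb])
    have hO : IsOpen (b ∩ g ⁻¹' V) := hg.continuousOn.isOpen_inter_preimage hb hV
    have hsub : ∀ r ∈ b ∩ g ⁻¹' V, W ⊆ (ψ r).dom := fun r hr => by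
      rw [← key r hr.1]; exact h (g r) hr.2
    refine ⟨b ∩ g ⁻¹' V, W, hO, hW, ⟨hxb, hr⟩, hs, hsub, ?_⟩
    have hcomp := hsm.comp (dSmooth_prodMk (dSmooth_subtype_mk (p := (· ∈ V))
      ((dSmooth_of_contDiffOn hO (hg.mono Set.inter_subset_left)).comp
        (dSmooth_fst (Y := W))) fun x => x.1.2.2) dSmooth_snd)
    convert hcomp using 1
    funext x
    have aux : ∀ (α β : SmoothPath Y) (_ : α = β) (s : ℝ) (ha : s ∈ α.dom) (hb : s ∈ β.dom),
        α.toFun ⟨s, ha⟩ = β.toFun ⟨s, hb⟩ := by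
      rintro α _ rfl s _ _; rfl
    exact aux _ _ (key x.1 x.1.2.1).symm _ _ _

/-- Initialized smooth paths `(α, t)`, `t ∈ dom α`, with the subspace diffeology of
`SmoothPath Y × ℝ`. -/
abbrev InitPath (Y : Type*) [DiffeologicalSpace Y] : Type _ :=
  {p : SmoothPath Y × ℝ // p.2 ∈ p.1.dom}

namespace SmoothPath

/-- The initialized path `(α, t)`. -/
def init (α : SmoothPath Y) (t : ℝ) (ht : t ∈ α.dom) : InitPath Y := ⟨(α, t), ht⟩

/-- The composite `f ∘ α` of a smooth path with a smooth map. -/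
def map (α : SmoothPath Y) (f : Y → Z) (hf : DSmooth f) : SmoothPath Z where
  dom := α.dom
  isOpen_dom := α.isOpen_dom
  ordConnected_dom := α.ordConnected_dom
  toFun s := f (α.toFun s)
  smooth := hf.comp α.smooth

/-- The composite `α ∘ f` of a smooth path `α` with a smooth path `f` in the domain of `α`. -/
def comp (α : SmoothPath Y) (f : SmoothPath ℝ) (hf : ∀ s, f.toFun s ∈ α.dom) : SmoothPath Y where
  dom := f.dom
  isOpen_dom := f.isOpen_dom
  ordConnected_dom := f.ordConnected_dom
  toFun s := α.toFun ⟨f.toFun s, hf s⟩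
  smooth := α.smooth.comp (dSmooth_subtype_mk f.smooth hf)

end SmoothPath

/-- Path-connectedness: any two points lie on a common smooth path. -/
def IsPathConnected (Y : Type*) [DiffeologicalSpace Y] : Prop :=
  ∀ x y : Y, ∃ α : SmoothPath Y, x ∈ Set.range α.toFun ∧ y ∈ Set.range α.toFun

/-- The smooth loops based at `y₀`: smooth paths whose domain contains `0` and `1` and which take
the value `y₀` there. -/
abbrev SmoothLoop (Y : Type*) [DiffeologicalSpace Y] (y₀ : Y) : Type _ :=
  {γ : SmoothPath Y // ∃ (h0 : (0 : ℝ) ∈ γ.dom) (h1 : (1 : ℝ) ∈ γ.dom),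
    γ.toFun ⟨0, h0⟩ = y₀ ∧ γ.toFun ⟨1, h1⟩ = y₀}

end Paths

/-! ## Diffeological groups, principal bundles and connections -/

/-- Diffeological groups: multiplication and inversion are smooth. -/
class DiffeologicalGroup (G : Type*) [Group G] [DiffeologicalSpace G] : Prop where
  smooth_mul : DSmooth (fun p : G × G => p.1 * p.2)
  smooth_inv : DSmooth (fun g : G => g⁻¹)

/-- A right action of `G` on `E` is smooth if `E × G → E × E`, `(ξ, g) ↦ (ξ, ξ g)`, is smooth.
Right actions of `G` are actions of `Gᵐᵒᵖ`, and `ξ <• g` denotes `ξ g`. -/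
class SmoothRightAction (G E : Type*) [Group G] [DiffeologicalSpace G] [DiffeologicalSpace E]
    [MulAction Gᵐᵒᵖ E] : Prop where
  smooth_action : DSmooth (fun p : E × G => (p.1, p.1 <• p.2))

section Bundles

variable (G : Type*) {E X : Type*} [Group G] [DiffeologicalSpace G]
  [DiffeologicalSpace E] [DiffeologicalSpace X] [MulAction Gᵐᵒᵖ E]

/-- Diffeological principal `G`-bundles `π : E → X`, for a smooth right action of `G` on `E`. -/
structure IsPrincipalBundle [SmoothRightAction G E] (π : E → X) : Prop where
  smooth_proj : DSmooth π
  surjective_proj : Function.Surjective π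
  /-- `(ξ, g) ↦ (ξ, ξ g)` is a diffeomorphism onto its image in `E × E`. -/
  diffeo_image : IsDiffeomorphism
    (Set.rangeFactorization (fun p : E × G => ((p.1, p.1 <• p.2) : E × E)))
  /-- The projection identifies `X` with the orbit space `E / G`. -/
  diffeo_quotient : ∃ Φ : X → Quotient (MulAction.orbitRel Gᵐᵒᵖ E), IsDiffeomorphism Φ ∧
    ∀ ξ, Φ (π ξ) = Quotient.mk (MulAction.orbitRel Gᵐᵒᵖ E) ξ

variable {G}

namespace SmoothPath

variable [SmoothRightAction G E]

/-- The path `s ↦ α(s) ρ(s)`, for a smooth path `α` in `E` and a smooth map `ρ : dom α → G`. -/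
def act (α : SmoothPath E) (ρ : α.dom → G) (hρ : DSmooth ρ) : SmoothPath E where
  dom := α.dom
  isOpen_dom := α.isOpen_dom
  ordConnected_dom := α.ordConnected_dom
  toFun s := α.toFun s <• ρ s
  smooth := (dSmooth_snd.comp (SmoothRightAction.smooth_action (G := G) (E := E))).comp
    (dSmooth_prodMk α.smooth hρ)

end SmoothPath

/-- Diffeological connections on `π : E → X`. For a path `α` in `E` and `t ∈ dom α`, the path
`A_t α` is the horizontal projection of `α` at time `t`. -/
structure Connection (G : Type*) {E X : Type*} [Group G] [DiffeologicalSpace G]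
    [DiffeologicalSpace E] [DiffeologicalSpace X] [MulAction Gᵐᵒᵖ E] [SmoothRightAction G E]
    (π : E → X) where
  /-- The map `(α, t) ↦ A_t α`. -/
  toFun : InitPath E → SmoothPath E
  smooth : DSmooth toFun
  /-- `dom (A_t α) = dom α`. -/
  dom_eq : ∀ (α : SmoothPath E) (t : ℝ) (ht : t ∈ α.dom), (toFun (α.init t ht)).dom = α.dom
  /-- `π ∘ A_t α = π ∘ α`. -/
  lifting : ∀ (α : SmoothPath E) (t : ℝ) (ht : t ∈ α.dom) (s : ℝ) (hs : s ∈ α.dom),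
    π ((toFun (α.init t ht)).toFun ⟨s, (dom_eq α t ht).symm ▸ hs⟩) = π (α.toFun ⟨s, hs⟩)
  /-- `(A_t α)(t) = α(t)`. -/
  basepoint : ∀ (α : SmoothPath E) (t : ℝ) (ht : t ∈ α.dom),
    (toFun (α.init t ht)).toFun ⟨t, (dom_eq α t ht).symm ▸ ht⟩ = α.toFun ⟨t, ht⟩
  /-- `A_t (α ρ) = (A_t α) ρ(t)` for smooth `ρ : dom α → G`. -/
  equivariance : ∀ (α : SmoothPath E) (ρ : α.dom → G) (hρ : DSmooth ρ) (t : ℝ) (ht : t ∈ α.dom),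
    toFun ((α.act ρ hρ).init t ht) =
      (toFun (α.init t ht)).act (fun _ => ρ ⟨t, ht⟩) dSmooth_const
  /-- `A_t (α ∘ f) = (A_{f(t)} α) ∘ f` for smooth paths `f` in `dom α`. -/
  reparametrization : ∀ (α : SmoothPath E) (f : SmoothPath ℝ) (hf : ∀ s, f.toFun s ∈ α.dom)
    (t : ℝ) (ht : t ∈ f.dom),
    toFun ((α.comp f hf).init t ht) =
      (toFun (α.init (f.toFun ⟨t, ht⟩) (hf ⟨t, ht⟩))).comp f
        (fun s => (dom_eq α _ (hf ⟨t, ht⟩)).symm ▸ hf s)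
  /-- `A_s (A_t α) = A_t α` for all `s, t ∈ dom α`: a horizontal projection is horizontal at all
  times. -/
  projection : ∀ (α : SmoothPath E) (t : ℝ) (ht : t ∈ α.dom) (s : ℝ) (hs : s ∈ α.dom),
    toFun ((toFun (α.init t ht)).init s ((dom_eq α t ht).symm ▸ hs)) = toFun (α.init t ht)

namespace Connection

variable [SmoothRightAction G E] {π : E → X}

/-- `A`-horizontal paths. -/
def IsHorizontal (A : Connection G π) (β : SmoothPath E) : Prop :=
  ∃ (t : ℝ) (ht : t ∈ β.dom), A.toFun (β.init t ht) = β

/-- `β` is the horizontal lift of the path `α` in `X` with value `ξ` at time `t`. -/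
def IsHorizontalLift (A : Connection G π) (α : SmoothPath X) (t : ℝ) (ξ : E)
    (β : SmoothPath E) : Prop :=
  A.IsHorizontal β ∧ (∃ ht : t ∈ β.dom, β.toFun ⟨t, ht⟩ = ξ) ∧
    ∃ hdom : β.dom = α.dom, ∀ s : β.dom, π (β.toFun s) = α.toFun ⟨s, hdom ▸ s.2⟩

/-- The holonomy representation of `A` at `ξ`: for a smooth loop `γ` based at `x₀ = π ξ`, the
element `g` of `G` such that the horizontal lift `β` of `γ` with `β(0) = ξ` has `β(1) = ξ g`.
(On a principal bundle the horizontal lift, hence `g`, exists and is unique.) -/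
def holonomy (A : Connection G π) (x₀ : X) (ξ : E) (γ : SmoothLoop X x₀) : G :=
  Classical.epsilon fun g : G => ∃ β : SmoothPath E, A.IsHorizontalLift γ.1 0 ξ β ∧
    ∃ h1 : (1 : ℝ) ∈ β.dom, β.toFun ⟨1, h1⟩ = ξ <• g

end Connection

/-- Isomorphisms of principal `G`-bundles over `X`: equivariant diffeomorphisms over `X`. -/
structure IsBundleIso (G : Type*) {E E' X : Type*} [Group G]
    [DiffeologicalSpace E] [DiffeologicalSpace E'] [MulAction Gᵐᵒᵖ E] [MulAction Gᵐᵒᵖ E']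
    (π : E → X) (π' : E' → X) (Ψ : E → E') : Prop where
  diffeo : IsDiffeomorphism Ψ
  equivariant : ∀ (ξ : E) (g : G), Ψ (ξ <• g) = Ψ ξ <• g
  proj_eq : ∀ ξ : E, π' (Ψ ξ) = π ξ

end Bundles

end DiffeologicalBundles

end

/-! Transport pairs of points simultaneously: `JointTransport` relates two points of E × E' when
horizontal curves in both bundles, over one base curve, lead from the first to the second. Start at
(ξg, ξ'). Moving the base point from ξ to ξg conjugates the holonomy, so the hypothesis says exactly
that joint transport around a loop multiplies both components by the same group element. Hence the
diagonal G-saturation of all pairs reachable from (ξg, ξ') is the graph of a map Ψ: every fibre is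
reached because X is path-connected, and the value is unique by the equality of holonomies
(`exists_equivariant_of_jointTransport`). Equivariance and compatibility with transport are built
into the graph, and the construction is symmetric in E and E', which yields the inverse.

The analytic point is smoothness (`dSmooth_of_jointTransport`). A plot of E is contracted radially
to one parameter, and the radial curves are lifted to E' from the matching starting point.
Projecting both families horizontally gives endpoints that correspond under Ψ. They are smooth in
the parameter because connections are smooth on path spaces, and they differ from the given plot by
a smooth G-valued map.

Finally, A_r α and A'_r(Ψ ∘ α) are horizontal over the same path and correspond under Ψ at time r,
hence at all times (`map_toFun_of_jointTransport`). -/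

open scoped Topology

noncomputable section

namespace DiffeologicalBundles

section Locality

variable {Y : Type*} [DiffeologicalSpace Y]

/-- A map on `ℝ` that agrees locally with smooth maps is smooth. -/
theorem dSmooth_real_of_locally {k : ℝ → Y}
    (h : ∀ t, ∃ (U : Set ℝ) (c : ℝ → Y), IsOpen U ∧ t ∈ U ∧ DSmooth c ∧ ∀ s ∈ U, k s = c s) :
    DSmooth k := by
  intro n p hp
  refine DiffeologicalSpace.locality fun x => ?_
  obtain ⟨U, c, hU, hx, hc, hk⟩ := h (p x)
  have hp' : ContDiff ℝ ∞ p := isPlot_iff_contDiff.1 hp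
  refine ⟨p ⁻¹' U, hU.preimage hp'.continuous, hx, fun {m f} hf hfs => ?_⟩
  have : (k ∘ p) ∘ f = c ∘ (p ∘ f) := funext fun r => hk _ (hf r)
  rw [this]
  exact hc _ _ (isPlot_reparam hp hfs)

/-- Smooth functions of two variables are smooth for the product diffeology. -/
theorem dSmooth_uncurry_of_contDiff {m n : ℕ}
    {F : EuclideanSpace ℝ (Fin m) × ℝ → EuclideanSpace ℝ (Fin n)} (hF : ContDiff ℝ ∞ F) :
    DSmooth F := by
  intro k q hq
  have h1 : ContDiff ℝ ∞ (fun r => (q r).1) := isPlot_iff_contDiff.1 hq.1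
  have h2 : ContDiff ℝ ∞ (fun r => (q r).2) := isPlot_iff_contDiff.1 hq.2
  exact isPlot_iff_contDiff.2 (hF.comp (h1.prodMk h2))

end Locality

/-! ### Smooth paths: equality and basic examples -/

namespace SmoothPath

variable {Y : Type*} [DiffeologicalSpace Y]

theorem toFun_congr {α β : SmoothPath Y} (h : α = β) {s : ℝ} (ha : s ∈ α.dom) (hb : s ∈ β.dom) :
    α.toFun ⟨s, ha⟩ = β.toFun ⟨s, hb⟩ := by
  subst h; rfl

theorem ext_of_dom {α β : SmoothPath Y} (hd : α.dom = β.dom)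
    (h : ∀ s (ha : s ∈ α.dom) (hb : s ∈ β.dom), α.toFun ⟨s, ha⟩ = β.toFun ⟨s, hb⟩) : α = β := by
  obtain ⟨u, hu, hu', f, hf⟩ := α
  obtain ⟨v, hv, hv', g, hg⟩ := β
  obtain rfl : u = v := hd
  obtain rfl : f = g := funext fun s => h s s.2 s.2
  rfl

theorem comp_congr {α β : SmoothPath Y} (h : α = β) {f : SmoothPath ℝ}
    (ha : ∀ s, f.toFun s ∈ α.dom) (hb : ∀ s, f.toFun s ∈ β.dom) : α.comp f ha = β.comp f hb := by
  subst h; rfl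

/-- A smooth map `ℝ → Y` as a smooth path. -/
def ofReal (c : ℝ → Y) (hc : DSmooth c) : SmoothPath Y where
  dom := Set.univ
  isOpen_dom := isOpen_univ
  ordConnected_dom := Set.ordConnected_univ
  toFun s := c s
  smooth := hc.comp dSmooth_val

/-- The inclusion of an open interval in `ℝ`. -/
def inclusion (U : Set ℝ) (hU : IsOpen U) (hU' : U.OrdConnected) : SmoothPath ℝ where
  dom := U
  isOpen_dom := hU
  ordConnected_dom := hU'
  toFun s := s
  smooth := dSmooth_val

end SmoothPath

theorem smul_op_mul {G E : Type*} [Group G] [MulAction Gᵐᵒᵖ E] (ξ : E) (g h : G) :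
    ξ <• (g * h) = (ξ <• g) <• h := by
  rw [MulOpposite.op_mul, mul_smul]

theorem smul_op_one {G E : Type*} [Group G] [MulAction Gᵐᵒᵖ E] (ξ : E) :
    ξ <• (1 : G) = ξ := by
  rw [MulOpposite.op_one, one_smul]

section Act

variable {G E : Type*} [Group G] [DiffeologicalSpace G] [DiffeologicalSpace E] [MulAction Gᵐᵒᵖ E]
  [SmoothRightAction G E]

theorem dSmooth_act {Z : Type*} [DiffeologicalSpace Z] {f : Z → E} {ρ : Z → G} (hf : DSmooth f)
    (hρ : DSmooth ρ) : DSmooth (fun z => f z <• ρ z) :=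
  (dSmooth_snd.comp (SmoothRightAction.smooth_action (G := G) (E := E))).comp
    (dSmooth_prodMk hf hρ)

theorem SmoothPath.act_const_congr {α β : SmoothPath E} (h : α = β) (g : G) :
    α.act (fun _ => g) dSmooth_const = β.act (fun _ => g) dSmooth_const := by
  subst h; rfl

end Act

/-! ### Fibres of principal bundles and smooth division -/

namespace IsPrincipalBundle

variable {G E X Z : Type*} [Group G] [DiffeologicalSpace G] [DiffeologicalSpace E]
  [DiffeologicalSpace X] [DiffeologicalSpace Z] [MulAction Gᵐᵒᵖ E] [SmoothRightAction G E]
  {π : E → X}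

theorem act_injective (hπ : IsPrincipalBundle G π) (ξ : E) {g h : G} (hgh : ξ <• g = ξ <• h) :
    g = h := by
  obtain ⟨-, k, -, hk, -⟩ := hπ.diffeo_image
  have : (ξ, g) = (ξ, h) := hk.injective (Subtype.ext (by simpa using hgh))
  exact congrArg Prod.snd this

theorem proj_act (hπ : IsPrincipalBundle G π) (ξ : E) (g : G) : π (ξ <• g) = π ξ := by
  obtain ⟨Φ, ⟨-, k, -, hk, -⟩, hΦ⟩ := hπ.diffeo_quotient
  apply hk.injective
  rw [hΦ, hΦ]
  exact Quotient.sound ⟨MulOpposite.op g, rfl⟩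

theorem exists_act_eq (hπ : IsPrincipalBundle G π) {ξ η : E} (h : π ξ = π η) :
    ∃ g : G, η = ξ <• g := by
  obtain ⟨Φ, -, hΦ⟩ := hπ.diffeo_quotient
  have h2 := hΦ η
  rw [← h, hΦ] at h2
  obtain ⟨g, hg⟩ := Quotient.exact h2.symm
  exact ⟨g.unop, hg.symm⟩

/-- Two smooth maps into the total space over the same map differ by a smooth map into `G`. -/
theorem exists_dSmooth_act_eq (hπ : IsPrincipalBundle G π) {f h : Z → E} (hf : DSmooth f)
    (hh : DSmooth h) (hfh : ∀ z, π (f z) = π (h z)) :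
    ∃ ρ : Z → G, DSmooth ρ ∧ ∀ z, h z = f z <• ρ z := by
  -- The second component of `k`, the inverse of (ξ, g) ↦ (ξ, ξg), is the smooth division map (ξ,
  -- ξg) ↦ g.
  obtain ⟨-, k, hks, -, hk⟩ := hπ.diffeo_image
  have hmem : ∀ z, (f z, h z) ∈ Set.range (fun p : E × G => ((p.1, p.1 <• p.2) : E × E)) := by
    intro z
    obtain ⟨g, hg⟩ := hπ.exists_act_eq (hfh z)
    exact ⟨(f z, g), by rw [hg]⟩
  refine ⟨fun z => (k ⟨(f z, h z), hmem z⟩).2, ?_, fun z => ?_⟩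
  · exact dSmooth_snd.comp (hks.comp (dSmooth_subtype_mk (dSmooth_prodMk hf hh) hmem))
  · have h1 := congrArg Subtype.val (hk ⟨(f z, h z), hmem z⟩)
    have h2 := congrArg Prod.fst h1
    have h3 := congrArg Prod.snd h1
    simp only [Set.rangeFactorization_coe] at h2 h3
    rw [h2] at h3
    exact h3.symm

/-- Plots of the base lift locally to the total space. -/
theorem exists_local_lift (hπ : IsPrincipalBundle G π) {n : ℕ}
    {p : EuclideanSpace ℝ (Fin n) → X} (hp : IsPlot p) (r₀ : EuclideanSpace ℝ (Fin n)) :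
    ∃ V : Set (EuclideanSpace ℝ (Fin n)), IsOpen V ∧ r₀ ∈ V ∧
      ∃ q : V → E, DSmooth q ∧ ∀ r : V, π (q r) = p r := by
  obtain ⟨Φ, ⟨hΦs, k, -, hk, -⟩, hΦ⟩ := hπ.diffeo_quotient
  obtain ⟨V, hV, hr, q, hq, h⟩ := hΦs _ _ hp r₀
  refine ⟨V, hV, hr, q, hq, fun r => hk.injective ?_⟩
  rw [hΦ, ← h r, Function.comp_apply]

end IsPrincipalBundle

/-! ### Horizontal paths: restriction, uniqueness, gluing, holonomy -/

namespace Connection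

variable {G E X : Type*} [Group G] [DiffeologicalSpace G] [DiffeologicalSpace E]
  [DiffeologicalSpace X] [MulAction Gᵐᵒᵖ E] [SmoothRightAction G E]
  {π : E → X} {A : Connection G π}

theorem toFun_init_congr {α β : SmoothPath E} (h : α = β) {t : ℝ} (ha : t ∈ α.dom)
    (hb : t ∈ β.dom) : A.toFun (α.init t ha) = A.toFun (β.init t hb) := by
  subst h; rfl

theorem isHorizontal_toFun (α : SmoothPath E) (t : ℝ) (ht : t ∈ α.dom) :
    A.IsHorizontal (A.toFun (α.init t ht)) :=
  ⟨t, (A.dom_eq α t ht).symm ▸ ht, A.projection α t ht t ht⟩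

/-- By the projection axiom, horizontality does not depend on the time at which it is tested. -/
theorem IsHorizontal.toFun_eq {β : SmoothPath E} (h : A.IsHorizontal β) {s : ℝ}
    (hs : s ∈ β.dom) : A.toFun (β.init s hs) = β := by
  obtain ⟨t, ht, h⟩ := h
  rw [← toFun_init_congr h (by rwa [A.dom_eq]) hs, A.projection β t ht s hs, h]

theorem IsHorizontal.comp {β : SmoothPath E} (h : A.IsHorizontal β) (f : SmoothPath ℝ)
    (hf : ∀ s, f.toFun s ∈ β.dom) {t : ℝ} (ht : t ∈ f.dom) : A.IsHorizontal (β.comp f hf) :=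
  ⟨t, ht, (A.reparametrization β f hf t ht).trans
    (SmoothPath.comp_congr (h.toFun_eq (hf ⟨t, ht⟩)) _ _)⟩

theorem IsHorizontal.act {β : SmoothPath E} (h : A.IsHorizontal β) (g : G) :
    A.IsHorizontal (β.act (fun _ => g) dSmooth_const) := by
  obtain ⟨t, ht, h⟩ := h
  exact ⟨t, ht, (A.equivariance β (fun _ => g) dSmooth_const t ht).trans
    (SmoothPath.act_const_congr h g)⟩

/-- The horizontal projection at time `t` is local on open intervals around `t`. -/
theorem toFun_eq_of_eqOn {α β : SmoothPath E} {U : Set ℝ} (hU : IsOpen U) (hU' : U.OrdConnected)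
    (hα : U ⊆ α.dom) (hβ : U ⊆ β.dom)
    (h : ∀ s (hs : s ∈ U), α.toFun ⟨s, hα hs⟩ = β.toFun ⟨s, hβ hs⟩) {t : ℝ} (ht : t ∈ U)
    {s : ℝ} (hs : s ∈ U) :
    (A.toFun (α.init t (hα ht))).toFun ⟨s, (A.dom_eq α t (hα ht)).symm ▸ hα hs⟩ =
      (A.toFun (β.init t (hβ ht))).toFun ⟨s, (A.dom_eq β t (hβ ht)).symm ▸ hβ hs⟩ := by
  -- Reparametrization by the inclusion of `U` is restriction to `U`, and both paths have the same
  -- restriction.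
  have h1 := A.reparametrization α (SmoothPath.inclusion U hU hU') (fun s => hα s.2) t ht
  have h2 := A.reparametrization β (SmoothPath.inclusion U hU hU') (fun s => hβ s.2) t ht
  have h3 : α.comp (SmoothPath.inclusion U hU hU') (fun s => hα s.2) =
      β.comp (SmoothPath.inclusion U hU hU') (fun s => hβ s.2) :=
    SmoothPath.ext_of_dom rfl fun s ha _ => h s ha
  exact SmoothPath.toFun_congr (h1.symm.trans ((toFun_init_congr h3 ht ht).trans h2)) hs hs

/-- Horizontal paths over the same path that agree at one time are equal. -/
theorem IsHorizontal.eq_of_proj_eq (hπ : IsPrincipalBundle G π) {β γ : SmoothPath E}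
    (hβ : A.IsHorizontal β) (hγ : A.IsHorizontal γ) (hd : β.dom = γ.dom)
    (hp : ∀ s (hs : s ∈ β.dom) (hs' : s ∈ γ.dom), π (β.toFun ⟨s, hs⟩) = π (γ.toFun ⟨s, hs'⟩))
    {t : ℝ} (ht : t ∈ β.dom) (ht' : t ∈ γ.dom) (h : β.toFun ⟨t, ht⟩ = γ.toFun ⟨t, ht'⟩) :
    β = γ := by
  have hs : DSmooth (fun s : β.dom => γ.toFun ⟨s, hd ▸ s.2⟩) :=
    γ.smooth.comp (dSmooth_subtype_mk dSmooth_val fun s : β.dom => hd ▸ s.2)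
  -- Write γ = βρ with ρ(t) = 1; then γ = A_t(βρ) = (A_t β)ρ(t) = β.
  obtain ⟨ρ, hρ, hργ⟩ := hπ.exists_dSmooth_act_eq β.smooth hs fun s => hp s s.2 _
  have hργ' : β.act ρ hρ = γ := SmoothPath.ext_of_dom hd fun s ha hb => (hργ ⟨s, ha⟩).symm
  have hρt : ρ ⟨t, ht⟩ = 1 := by
    refine hπ.act_injective (β.toFun ⟨t, ht⟩) ?_
    rw [← hργ ⟨t, ht⟩, smul_op_one, h]
  have h1 := A.equivariance β ρ hρ t ht
  rw [toFun_init_congr hργ' ht ht', hγ.toFun_eq ht'] at h1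
  rw [h1, SmoothPath.act_const_congr (hβ.toFun_eq ht)]
  refine SmoothPath.ext_of_dom rfl fun s _ _ => ?_
  change _ = β.toFun _ <• ρ ⟨t, ht⟩
  rw [hρt, smul_op_one]
  rfl

/-- Horizontal paths defined on all of `ℝ`, as functions. -/
def IsHorizontalCurve (A : Connection G π) (c : ℝ → E) : Prop :=
  ∃ hc : DSmooth c, A.IsHorizontal (SmoothPath.ofReal c hc)

theorem IsHorizontal.comp_curve {β : SmoothPath E} (h : A.IsHorizontal β) {f : ℝ → ℝ}
    (hf : ContDiff ℝ ∞ f) (hfβ : ∀ s, f s ∈ β.dom) :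
    A.IsHorizontalCurve (fun s => β.toFun ⟨f s, hfβ s⟩) :=
  ⟨β.smooth.comp (dSmooth_subtype_mk hf.dSmooth hfβ),
    h.comp (SmoothPath.ofReal f hf.dSmooth) (fun s => hfβ s) (t := 0) trivial⟩

theorem IsHorizontalCurve.comp {c : ℝ → E} (h : A.IsHorizontalCurve c) {f : ℝ → ℝ}
    (hf : ContDiff ℝ ∞ f) : A.IsHorizontalCurve (fun s => c (f s)) := by
  obtain ⟨hc, h⟩ := h
  exact h.comp_curve hf fun _ => trivial

theorem IsHorizontalCurve.act {c : ℝ → E} (h : A.IsHorizontalCurve c) (g : G) :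
    A.IsHorizontalCurve (fun s => c s <• g) := by
  obtain ⟨hc, h⟩ := h
  exact ⟨dSmooth_act hc dSmooth_const, h.act g⟩

/-- Horizontality is preserved under gluing along an overlap. -/
theorem IsHorizontalCurve.glue {c d k : ℝ → E} (hc : A.IsHorizontalCurve c)
    (hd : A.IsHorizontalCurve d) {a b : ℝ} (hab : a < b) (hkc : ∀ t < b, k t = c t)
    (hkd : ∀ t > a, k t = d t) : A.IsHorizontalCurve k := by
  obtain ⟨hcs, hc⟩ := hc
  obtain ⟨hds, hd⟩ := hd
  have hk : DSmooth k := by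
    refine dSmooth_real_of_locally fun t => ?_
    rcases lt_or_ge t b with h | h
    · exact ⟨Set.Iio b, c, isOpen_Iio, h, hcs, hkc⟩
    · exact ⟨Set.Ioi a, d, isOpen_Ioi, hab.trans_le h, hds, hkd⟩
  -- Projecting at a time in the overlap allows comparison with both `c` and `d`, since the
  -- projection is local only around its base time.
  obtain ⟨t, hat, htb⟩ := exists_between hab
  refine ⟨hk, t, trivial, SmoothPath.ext_of_dom (A.dom_eq _ _ _) fun s hs _ => ?_⟩
  rcases lt_or_ge s b with h | h
  · have := toFun_eq_of_eqOn (A := A) (α := SmoothPath.ofReal k hk) (β := SmoothPath.ofReal c hcs)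
      isOpen_Iio Set.ordConnected_Iio (Set.subset_univ _) (Set.subset_univ _) hkc htb h
    exact this.trans ((SmoothPath.toFun_congr (hc.toFun_eq _) _ trivial).trans (hkc s h).symm)
  · have := toFun_eq_of_eqOn (A := A) (α := SmoothPath.ofReal k hk) (β := SmoothPath.ofReal d hds)
      isOpen_Ioi Set.ordConnected_Ioi (Set.subset_univ _) (Set.subset_univ _) hkd hat
      (hab.trans_le h)
    exact this.trans ((SmoothPath.toFun_congr (hd.toFun_eq _) _ trivial).trans
      (hkd s (hab.trans_le h)).symm)

/-- Uniqueness of horizontal lifts and freeness of the action leave only one possible value for the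
choice made in `holonomy`. The given curve `c` shows that the choice is not vacuous. -/
theorem holonomy_eq (hπ : IsPrincipalBundle G π) {x₀ : X} {ξ : E} {γ : SmoothLoop X x₀}
    {c : ℝ → E} (hc : A.IsHorizontalCurve c) (hd : γ.1.dom = Set.univ)
    (hp : ∀ s : γ.1.dom, π (c s) = γ.1.toFun s) (h0 : c 0 = ξ) {h : G} (h1 : c 1 = ξ <• h) :
    A.holonomy x₀ ξ γ = h := by
  obtain ⟨hcs, hc⟩ := hc
  have hex : ∃ g : G, ∃ β : SmoothPath E, A.IsHorizontalLift γ.1 0 ξ β ∧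
      ∃ h1 : (1 : ℝ) ∈ β.dom, β.toFun ⟨1, h1⟩ = ξ <• g :=
    ⟨h, SmoothPath.ofReal c hcs, ⟨hc, ⟨trivial, h0⟩, hd.symm, fun s => hp ⟨s, hd ▸ trivial⟩⟩,
      trivial, h1⟩
  obtain ⟨β, ⟨hβ, ⟨hβ0, hβξ⟩, hβd, hβp⟩, hβ1, hβe⟩ := Classical.epsilon_spec hex
  have heq : β = SmoothPath.ofReal c hcs :=
    hβ.eq_of_proj_eq hπ hc (hβd.trans hd)
      (fun s hs _ => (hβp ⟨s, hs⟩).trans (hp ⟨s, hβd ▸ hs⟩).symm) hβ0 trivial (hβξ.trans h0.symm)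
  refine hπ.act_injective ξ (hβe.symm.trans ?_)
  exact (SmoothPath.toFun_congr heq hβ1 trivial).trans h1

end Connection

/-! ### Joint parallel transport in two bundles -/

section Transport

variable {G E E' X : Type*} [Group G] [DiffeologicalSpace G] [DiffeologicalSpace X]
  [DiffeologicalSpace E] [MulAction Gᵐᵒᵖ E] [SmoothRightAction G E]
  [DiffeologicalSpace E'] [MulAction Gᵐᵒᵖ E'] [SmoothRightAction G E']
  {π : E → X} {π' : E' → X}

/-- `p` and `q` in `E × E'` are joined by a pair of horizontal curves over a common curve in `X`,
which is constant near both ends. -/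
def JointTransport (A : Connection G π) (A' : Connection G π') (p q : E × E') : Prop :=
  ∃ (c : ℝ → E) (c' : ℝ → E'), A.IsHorizontalCurve c ∧ A'.IsHorizontalCurve c' ∧
    (∀ t, π (c t) = π' (c' t)) ∧
    ∃ a b : ℝ, (∀ t ≤ a, (c t, c' t) = p) ∧ ∀ t ≥ b, (c t, c' t) = q

namespace JointTransport

variable {A : Connection G π} {A' : Connection G π'}

theorem proj_eq_right {p q : E × E'} (h : JointTransport A A' p q) : π q.1 = π' q.2 := by
  obtain ⟨c, c', -, -, hp, a, b, -, hb⟩ := h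
  rw [← hb b le_rfl]
  exact hp b

theorem swap {p q : E × E'} (h : JointTransport A A' p q) :
    JointTransport A' A p.swap q.swap := by
  obtain ⟨c, c', hc, hc', hp, a, b, ha, hb⟩ := h
  exact ⟨c', c, hc', hc, fun t => (hp t).symm, a, b,
    fun t ht => congrArg Prod.swap (ha t ht), fun t ht => congrArg Prod.swap (hb t ht)⟩

theorem symm {p q : E × E'} (h : JointTransport A A' p q) : JointTransport A A' q p := by
  obtain ⟨c, c', hc, hc', hp, a, b, ha, hb⟩ := h
  exact ⟨_, _, hc.comp contDiff_neg, hc'.comp contDiff_neg, fun t => hp (-t), -b, -a,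
    fun t ht => hb _ (by linarith), fun t ht => ha _ (by linarith)⟩

/-- The curves are constant near their ends, so concatenation remains smooth and horizontal. -/
theorem trans {p q r : E × E'} (h : JointTransport A A' p q) (h' : JointTransport A A' q r) :
    JointTransport A A' p r := by
  obtain ⟨c, c', hc, hc', hp, a, b, ha, hb⟩ := h
  obtain ⟨d, d', hd, hd', hp', a', b', ha', hb'⟩ := h'
  -- The second pair is delayed until its constant initial phase ends at time `m + 1`. On (`m`, `m +
  -- 1`) both pairs rest at `q`, which is the overlap needed for gluing. The maximum with `a` keeps
  -- the start at `p` within the first branch.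
  set m := max a b with hm
  have hs : ContDiff ℝ ∞ (fun t : ℝ => t - (m + 1 - a')) := contDiff_id.sub contDiff_const
  have hglue : ∀ t, m < t → t < m + 1 →
      (c t, c' t) = (d (t - (m + 1 - a')), d' (t - (m + 1 - a'))) := fun t h1 h2 =>
    (hb t ((le_max_right a b).trans h1.le)).trans (ha' _ (by linarith)).symm
  refine ⟨fun t => if t ≤ m then c t else d (t - (m + 1 - a')),
    fun t => if t ≤ m then c' t else d' (t - (m + 1 - a')),
    hc.glue (hd.comp hs) (lt_add_one m) ?_ ?_, hc'.glue (hd'.comp hs) (lt_add_one m) ?_ ?_, ?_,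
    a, max (m + 1) (b' + (m + 1 - a')), ?_, ?_⟩
  · intro t ht
    split_ifs with h
    · rfl
    · exact (congrArg Prod.fst (hglue t (not_le.1 h) ht)).symm
  · exact fun t ht => if_neg (not_le.2 ht)
  · intro t ht
    split_ifs with h
    · rfl
    · exact (congrArg Prod.snd (hglue t (not_le.1 h) ht)).symm
  · exact fun t ht => if_neg (not_le.2 ht)
  · intro t
    dsimp only
    split_ifs
    exacts [hp t, hp' _]
  · intro t ht
    have : t ≤ m := ht.trans (le_max_left a b)
    simp only [if_pos this]
    exact ha t ht
  · intro t ht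
    have h1 : m + 1 ≤ t := (le_max_left _ _).trans ht
    have h2 : b' + (m + 1 - a') ≤ t := (le_max_right _ _).trans ht
    have : ¬ t ≤ m := by linarith
    simp only [if_neg this]
    exact hb' _ (by linarith)

/-- The two factors may be moved by independent group elements, as each translation preserves
horizontality and the base curve. -/
theorem act (hπ : IsPrincipalBundle G π) (hπ' : IsPrincipalBundle G π') {p q : E × E'}
    (h : JointTransport A A' p q) (g g' : G) :
    JointTransport A A' (p.1 <• g, p.2 <• g') (q.1 <• g, q.2 <• g') := by
  obtain ⟨c, c', hc, hc', hp, a, b, ha, hb⟩ := h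
  refine ⟨_, _, hc.act g, hc'.act g', fun t => ?_, a, b, fun t ht => ?_, fun t ht => ?_⟩
  · rw [hπ.proj_act, hπ'.proj_act, hp]
  · rw [← ha t ht]
  · rw [← hb t ht]

/-- Horizontal paths over the same path relate any two of their points. -/
theorem of_isHorizontal {β : SmoothPath E} {β' : SmoothPath E'} (hβ : A.IsHorizontal β)
    (hβ' : A'.IsHorizontal β') (hd : β.dom = β'.dom)
    (hp : ∀ s (hs : s ∈ β.dom) (hs' : s ∈ β'.dom),
      π (β.toFun ⟨s, hs⟩) = π' (β'.toFun ⟨s, hs'⟩))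
    {s t : ℝ} (hs : s ∈ β.dom) (ht : t ∈ β.dom) :
    JointTransport A A' (β.toFun ⟨s, hs⟩, β'.toFun ⟨s, hd ▸ hs⟩)
      (β.toFun ⟨t, ht⟩, β'.toFun ⟨t, hd ▸ ht⟩) := by
  -- This reparametrization rests at `s` up to time 0 and at `t` from time 1 on, and stays in the
  -- domain by convexity.
  have hf : ContDiff ℝ ∞ (fun r : ℝ => s + Real.smoothTransition r * (t - s)) :=
    contDiff_const.add (Real.smoothTransition.contDiff.mul contDiff_const)
  have hfd : ∀ r : ℝ, s + Real.smoothTransition r * (t - s) ∈ β.dom := fun r =>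
    β.ordConnected_dom.convex.add_smul_sub_mem hs ht
      ⟨Real.smoothTransition.nonneg r, Real.smoothTransition.le_one r⟩
  refine ⟨_, _, hβ.comp_curve hf hfd, hβ'.comp_curve hf (fun r => hd ▸ hfd r),
    fun r => hp _ _ _, 0, 1, fun r hr => ?_, fun r hr => ?_⟩
  · simp [Real.smoothTransition.zero_of_nonpos hr]
  · simp [Real.smoothTransition.one_of_one_le hr]

theorem holonomy_eq (hπ : IsPrincipalBundle G π) (hπ' : IsPrincipalBundle G π') {x₀ : X} {ξ : E}
    (hξ : π ξ = x₀) {ξ' : E'} {h h' : G}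
    (hT : JointTransport A A' (ξ, ξ') (ξ <• h, ξ' <• h')) :
    ∃ γ : SmoothLoop X x₀, A.holonomy x₀ ξ γ = h ∧ A'.holonomy x₀ ξ' γ = h' := by
  obtain ⟨c, c', hc, hc', hp, a, b, ha, hb⟩ := hT
  -- Loops are evaluated at times 0 and 1, so these are sent to `a` and `b`; no order between `a`
  -- and `b` is needed.
  have hf : ContDiff ℝ ∞ (fun r : ℝ => a + r * (b - a)) :=
    contDiff_const.add (contDiff_id.mul contDiff_const)
  have h0 : (c (a + 0 * (b - a)), c' (a + 0 * (b - a))) = (ξ, ξ') := ha _ (by simp)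
  have h1 : (c (a + 1 * (b - a)), c' (a + 1 * (b - a))) = (ξ <• h, ξ' <• h') := hb _ (by simp)
  have hcf := hc.comp hf
  have hcf' := hc'.comp hf
  refine ⟨⟨SmoothPath.ofReal (fun r => π (c (a + r * (b - a))))
    (hπ.smooth_proj.comp hcf.1), trivial, trivial, ?_, ?_⟩, ?_, ?_⟩
  · exact (congrArg π (congrArg Prod.fst h0)).trans hξ
  · exact ((congrArg π (congrArg Prod.fst h1)).trans (hπ.proj_act ξ h)).trans hξ
  · exact Connection.holonomy_eq hπ hcf rfl (fun s => rfl) (congrArg Prod.fst h0)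
      (congrArg Prod.fst h1)
  · exact Connection.holonomy_eq hπ' hcf' rfl (fun s => (hp _).symm) (congrArg Prod.snd h0)
      (congrArg Prod.snd h1)

end JointTransport

/-- Smooth curves in the base lift locally. -/
theorem IsPrincipalBundle.exists_lift_ball (hπ : IsPrincipalBundle G π) {c : ℝ → X}
    (hc : DSmooth c) : ∃ δ > 0, ∀ ε, ε ≤ δ → ∃ β : SmoothPath E, β.dom = Metric.ball 0 ε ∧
      ∀ s (hs : s ∈ β.dom), π (β.toFun ⟨s, hs⟩) = c s := by
  have hcoord : ContDiff ℝ ∞ (fun r : EuclideanSpace ℝ (Fin 1) => r 0) :=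
    contDiff_euclidean.1 contDiff_id 0
  have hline : ContDiff ℝ ∞ (fun s : ℝ => (WithLp.toLp 2 fun _ => s : EuclideanSpace ℝ (Fin 1))) :=
    contDiff_euclidean.2 fun _ => contDiff_id
  obtain ⟨V, hV, h0, q, hq, hqc⟩ := hπ.exists_local_lift (hc _ _ hcoord.isPlot)
    (WithLp.toLp 2 fun _ => (0 : ℝ))
  obtain ⟨δ, hδ, hδV⟩ := Metric.isOpen_iff.1 (hV.preimage hline.continuous) 0 h0
  refine ⟨δ, hδ, fun ε hε => ?_⟩
  have hεV := (Metric.ball_subset_ball hε).trans hδV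
  exact ⟨⟨Metric.ball 0 ε, Metric.isOpen_ball, (convex_ball 0 ε).ordConnected,
    fun s => q ⟨_, hεV s.2⟩, hq.comp (dSmooth_subtype_mk
      (hline.dSmooth.comp dSmooth_val) fun s => hεV s.2)⟩, rfl, fun s hs => hqc _⟩

/-- Local lifts of `c` to both bundles, over a common interval around 0, become horizontal after
projection at time 0. -/
theorem JointTransport.eventually_exists (hπ : IsPrincipalBundle G π)
    (hπ' : IsPrincipalBundle G π') (A : Connection G π) (A' : Connection G π')
    {c : ℝ → X} (hc : DSmooth c) :
    ∀ᶠ t in 𝓝 (0 : ℝ), ∃ p q : E × E', π p.1 = c 0 ∧ π q.1 = c t ∧ JointTransport A A' p q := by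
  obtain ⟨δ, hδ, hl⟩ := hπ.exists_lift_ball hc
  obtain ⟨δ', hδ', hl'⟩ := hπ'.exists_lift_ball hc
  have hmin : 0 < min δ δ' := lt_min hδ hδ'
  obtain ⟨β, hβ, hβc⟩ := hl (min δ δ') (min_le_left _ _)
  obtain ⟨β', hβ', hβc'⟩ := hl' (min δ δ') (min_le_right _ _)
  have h0 : (0 : ℝ) ∈ β.dom := hβ ▸ Metric.mem_ball_self hmin
  have h0' : (0 : ℝ) ∈ β'.dom := hβ' ▸ Metric.mem_ball_self hmin
  filter_upwards [Metric.ball_mem_nhds 0 hmin] with t ht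
  have hdA := A.dom_eq β 0 h0
  have hdA' := A'.dom_eq β' 0 h0'
  have hA : ∀ s hs, π ((A.toFun (β.init 0 h0)).toFun ⟨s, hs⟩) = c s := fun s hs =>
    (A.lifting β 0 h0 s (hdA ▸ hs)).trans (hβc s _)
  have hA' : ∀ s hs, π' ((A'.toFun (β'.init 0 h0')).toFun ⟨s, hs⟩) = c s := fun s hs =>
    (A'.lifting β' 0 h0' s (hdA' ▸ hs)).trans (hβc' s _)
  exact ⟨_, _, hA _ _, hA _ _, JointTransport.of_isHorizontal
    (Connection.isHorizontal_toFun β 0 h0) (Connection.isHorizontal_toFun β' 0 h0')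
    (by rw [hdA, hdA', hβ, hβ']) (fun s hs hs' => (hA s hs).trans (hA' s hs').symm)
    (s := 0) (t := t) (hdA ▸ h0) (by rw [hdA, hβ]; exact ht)⟩

theorem JointTransport.exists_of_isPathConnected (hX : IsPathConnected X)
    (hπ : IsPrincipalBundle G π) (hπ' : IsPrincipalBundle G π') (A : Connection G π)
    (A' : Connection G π') {p : E × E'} (hp : π p.1 = π' p.2) (y : X) :
    ∃ q : E × E', π q.1 = y ∧ JointTransport A A' p q := by
  obtain ⟨α, ⟨⟨s, hs⟩, hαs⟩, ⟨t, ht⟩, hαt⟩ := hX (π p.1) y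
  -- Only the base points matter: a transport can be translated in each bundle so that it starts at
  -- any prescribed pair over the same point.
  have move : ∀ {p q r : E × E'}, JointTransport A A' p q → π p.1 = π r.1 → π r.1 = π' r.2 →
      ∃ r', π r'.1 = π q.1 ∧ JointTransport A A' r r' := by
    intro p q r h hpr hr
    obtain ⟨g, hg⟩ := hπ.exists_act_eq hpr
    obtain ⟨g', hg'⟩ := hπ'.exists_act_eq (h.symm.proj_eq_right.symm.trans (hpr.trans hr))
    refine ⟨(q.1 <• g, q.2 <• g'), hπ.proj_act _ _, ?_⟩
    have := h.act hπ hπ' g g'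
    rwa [← hg, ← hg'] at this
  suffices H : ∃ (hs : s ∈ α.dom) (ht : t ∈ α.dom) (p q : E × E'),
      π p.1 = α.toFun ⟨s, hs⟩ ∧ π q.1 = α.toFun ⟨t, ht⟩ ∧ JointTransport A A' p q by
    obtain ⟨_, _, p₁, q₁, hp₁, hq₁, h⟩ := H
    obtain ⟨r, hr, h⟩ := move h (hp₁.trans hαs) hp
    exact ⟨r, hr.trans (hq₁.trans hαt), h⟩
  -- Being joined by some transport is a local, transitive and symmetric relation on a connected
  -- interval, so it holds between all times. No global horizontal lift of `α` is needed.
  refine α.ordConnected_dom.isPreconnected.induction₂ (fun s t => ∃ (hs : s ∈ α.dom)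
    (ht : t ∈ α.dom) (p q : E × E'), π p.1 = α.toFun ⟨s, hs⟩ ∧ π q.1 = α.toFun ⟨t, ht⟩ ∧
      JointTransport A A' p q) ?_ ?_ ?_ hs ht
  · intro x hx
    obtain ⟨ε, hε, hεα⟩ := Metric.isOpen_iff.1 α.isOpen_dom x hx
    -- `φ` stretches a small interval around `x` to all of ℝ, with 0 going to `x`, so the local
    -- result for curves on ℝ applies.
    set φ := OpenPartialHomeomorph.univBall x ε with hφ
    have hφα : ∀ s, φ s ∈ α.dom := fun s => hεα (by
      have := φ.map_source (x := s) (by simp [hφ])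
      rwa [hφ, OpenPartialHomeomorph.univBall_target x hε] at this)
    have hc : DSmooth (fun s => α.toFun ⟨φ s, hφα s⟩) := α.smooth.comp
      (dSmooth_subtype_mk OpenPartialHomeomorph.contDiff_univBall.dSmooth hφα)
    have hx' : x ∈ φ.target := by
      rw [hφ, OpenPartialHomeomorph.univBall_target x hε]; exact Metric.mem_ball_self hε
    have hφ0 : φ 0 = x := OpenPartialHomeomorph.univBall_apply_zero x ε
    have hφx : φ.symm x = 0 := by
      rw [← hφ0]; exact φ.left_inv (by simp [hφ])
    have hev := (φ.continuousAt_symm hx').tendsto.eventually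
      (hφx ▸ JointTransport.eventually_exists hπ hπ' A A' hc)
    filter_upwards [hev.filter_mono nhdsWithin_le_nhds, mem_nhdsWithin_of_mem_nhds
      (φ.open_target.mem_nhds hx')] with y hy hyt
    obtain ⟨p, q, hp, hq, h⟩ := hy
    have hyφ : φ (φ.symm y) = y := φ.right_inv hyt
    refine ⟨hx, hyφ ▸ hφα _, p, q, hp.trans ?_, hq.trans ?_, h⟩
    · congr
      exact φ.right_inv hx'
    · congr
  · rintro x y z - - - ⟨hx, hy, p, q, hp, hq, h⟩ ⟨_, hz, p', q', hp', hq', h'⟩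
    obtain ⟨r, hr, h₂⟩ := move h' (hp'.trans hq.symm) h.proj_eq_right
    exact ⟨hx, hz, p, r, hp, hr.trans hq', h.trans h₂⟩
  · rintro x y - - ⟨hx, hy, p, q, hp, hq, h⟩
    exact ⟨hy, hx, q, p, hq, hp, h.symm⟩

end Transport

/-! ### Smooth dependence of horizontal projections on parameters -/

theorem SmoothPath.isPlot_eval {Y : Type*} [DiffeologicalSpace Y] {n : ℕ}
    {ψ : EuclideanSpace ℝ (Fin n) → SmoothPath Y} (hψ : IsPlot ψ) {t : ℝ}
    (ht : ∀ r, t ∈ (ψ r).dom) : IsPlot (fun r => (ψ r).toFun ⟨t, ht r⟩) := by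
  refine DiffeologicalSpace.locality fun r₀ => ?_
  obtain ⟨V, W, hV, hW, hr, hs, h, hsm⟩ := hψ r₀ t (ht r₀)
  refine ⟨V, hV, hr, fun {m f} hfV hf => ?_⟩
  exact hsm m (fun r => (⟨f r, hfV r⟩, ⟨t, hs⟩)) ⟨hf.isPlot, isPlot_const⟩

section Family

variable {G E X : Type*} [Group G] [DiffeologicalSpace G] [DiffeologicalSpace X]
  [DiffeologicalSpace E] [MulAction Gᵐᵒᵖ E] [SmoothRightAction G E] {π : E → X}

theorem dSmooth_curve {m : ℕ} {η : EuclideanSpace ℝ (Fin m) × ℝ → E} (hη : DSmooth η)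
    (r : EuclideanSpace ℝ (Fin m)) : DSmooth (fun s : ℝ => η (r, s)) :=
  hη.comp (dSmooth_prodMk dSmooth_const dSmooth_id')

/-- The endpoint at time `1` of the horizontal projection at time `0` of the curve `η (r, ·)`. -/
def Connection.endpoint (A : Connection G π) {m : ℕ} {η : EuclideanSpace ℝ (Fin m) × ℝ → E}
    (hη : DSmooth η) (r : EuclideanSpace ℝ (Fin m)) : E :=
  (A.toFun ((SmoothPath.ofReal _ (dSmooth_curve hη r)).init 0 trivial)).toFun
    ⟨1, (A.dom_eq _ _ _).symm ▸ trivial⟩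

/-- A smooth family of curves is a plot of the path space; the connection maps it to a plot, and
evaluation at a fixed time is smooth. This is where smoothness of the connection enters. -/
theorem Connection.isPlot_endpoint (A : Connection G π) {m : ℕ}
    {η : EuclideanSpace ℝ (Fin m) × ℝ → E} (hη : DSmooth η) : IsPlot (A.endpoint hη) := by
  refine SmoothPath.isPlot_eval
    (ψ := fun r => A.toFun ((SmoothPath.ofReal _ (dSmooth_curve hη r)).init 0 trivial))
    (A.smooth _ _ ⟨fun r₀ s₀ _ => ?_, isPlot_const⟩) _
  refine ⟨Set.univ, Set.univ, isOpen_univ, isOpen_univ, trivial, trivial,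
    fun _ _ => subset_rfl, ?_⟩
  exact hη.comp (dSmooth_prodMk (dSmooth_val.comp dSmooth_fst) (dSmooth_val.comp dSmooth_snd))

theorem Connection.proj_endpoint (A : Connection G π) {m : ℕ}
    {η : EuclideanSpace ℝ (Fin m) × ℝ → E} (hη : DSmooth η) (r : EuclideanSpace ℝ (Fin m)) :
    π (A.endpoint hη r) = π (η (r, 1)) :=
  A.lifting (SmoothPath.ofReal _ (dSmooth_curve hη r)) 0 trivial 1 trivial

end Family

/-! ### The bundle isomorphism defined by joint transport -/

section Iso

variable {G E E' X : Type*} [Group G] [DiffeologicalSpace G] [DiffeologicalSpace X]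
  [DiffeologicalSpace E] [MulAction Gᵐᵒᵖ E] [SmoothRightAction G E]
  [DiffeologicalSpace E'] [MulAction Gᵐᵒᵖ E'] [SmoothRightAction G E']
  {π : E → X} {π' : E' → X} {A : Connection G π} {A' : Connection G π'}

theorem JointTransport.endpoint {m : ℕ} {η : EuclideanSpace ℝ (Fin m) × ℝ → E} (hη : DSmooth η)
    {η' : EuclideanSpace ℝ (Fin m) × ℝ → E'} (hη' : DSmooth η')
    (h : ∀ x, π (η x) = π' (η' x)) (r : EuclideanSpace ℝ (Fin m)) :
    JointTransport A A' (η (r, 0), η' (r, 0)) (A.endpoint hη r, A'.endpoint hη' r) := by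
  set α := SmoothPath.ofReal _ (dSmooth_curve hη r)
  set α' := SmoothPath.ofReal _ (dSmooth_curve hη' r)
  have hd := A.dom_eq α 0 trivial
  have hd' := A'.dom_eq α' 0 trivial
  have := JointTransport.of_isHorizontal
    (Connection.isHorizontal_toFun (A := A) α 0 trivial)
    (Connection.isHorizontal_toFun (A := A') α' 0 trivial)
    (hd.trans hd'.symm) (fun s hs hs' => (A.lifting α 0 trivial s trivial).trans
      ((h (r, s)).trans (A'.lifting α' 0 trivial s trivial).symm))
    (s := 0) (t := 1) (hd ▸ trivial) (hd ▸ trivial)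
  rw [A.basepoint α 0 trivial, A'.basepoint α' 0 trivial] at this
  exact this

/-- An equivariant map over the base that is compatible with horizontal transport is smooth. -/
theorem dSmooth_of_jointTransport [DiffeologicalGroup G]
    (hπ : IsPrincipalBundle G π) (hπ' : IsPrincipalBundle G π')
    {Ψ : E → E'} (hΨ : ∀ (ξ : E) (g : G), Ψ (ξ <• g) = Ψ ξ <• g) (hp : ∀ ξ, π' (Ψ ξ) = π ξ)
    (hT : ∀ p q : E × E', JointTransport A A' p q → p.2 = Ψ p.1 → q.2 = Ψ q.1) : DSmooth Ψ := by
  intro n p hpl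
  refine DiffeologicalSpace.locality fun r₀ => ?_
  obtain ⟨V, hV, hr, q, hq, hqp⟩ := hπ'.exists_local_lift (hπ.smooth_proj _ _ hpl) r₀
  obtain ⟨ε, hε, hεV⟩ := Metric.isOpen_iff.1 hV r₀ hr
  -- The local lift `q` is arbitrary; `k` adjusts it so that the two families of curves start at
  -- corresponding points.
  obtain ⟨k, hk⟩ : ∃ k : G, Ψ (p r₀) = q ⟨r₀, hr⟩ <• k :=
    hπ'.exists_act_eq ((hqp ⟨r₀, hr⟩).trans (hp _).symm)
  refine ⟨Metric.ball r₀ ε, Metric.isOpen_ball, Metric.mem_ball_self hε, fun {m f} hfu hf => ?_⟩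
  -- Radial contraction of `f` to `r₀`; the smooth transition keeps it inside the ball for all real
  -- times.
  set F : EuclideanSpace ℝ (Fin m) × ℝ → EuclideanSpace ℝ (Fin n) :=
    fun x => r₀ + Real.smoothTransition x.2 • (f x.1 - r₀) with hF
  have hFs : DSmooth F := dSmooth_uncurry_of_contDiff (contDiff_const.add
    ((Real.smoothTransition.contDiff.comp contDiff_snd).smul
      ((hf.comp contDiff_fst).sub contDiff_const)))
  have hFV : ∀ x, F x ∈ V := fun x => hεV ((convex_ball r₀ ε).add_smul_sub_mem
    (Metric.mem_ball_self hε) (hfu x.1)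
    ⟨Real.smoothTransition.nonneg _, Real.smoothTransition.le_one _⟩)
  have hF0 : ∀ r, F (r, 0) = r₀ := fun r => by simp [hF]
  have hF1 : ∀ r, F (r, 1) = f r := fun r => by simp [hF]
  have hη : DSmooth (fun x => p (F x)) := hpl.dSmooth.comp hFs
  have hη' : DSmooth (fun x => q ⟨F x, hFV x⟩ <• k) :=
    dSmooth_act (hq.comp (dSmooth_subtype_mk hFs hFV)) dSmooth_const
  have hends : ∀ r, A'.endpoint hη' r = Ψ (A.endpoint hη r) := fun r => by
    refine hT _ _ (JointTransport.endpoint hη hη' (fun x => ?_) r) ?_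
    · rw [hπ'.proj_act, hqp]; rfl
    · simp only [hF0, hk]
  -- The horizontal endpoint lies over the same base point as `p (f r)` but may differ from it; the
  -- smooth correction `ρ` passes through `Ψ` by equivariance.
  obtain ⟨ρ, hρ, hρf⟩ := hπ.exists_dSmooth_act_eq (A.isPlot_endpoint hη).dSmooth
    (isPlot_reparam hpl hf).dSmooth fun r => by
      rw [A.proj_endpoint, hF1]; rfl
  have : (Ψ ∘ p) ∘ f = fun r => A'.endpoint hη' r <• ρ r := funext fun r => by
    rw [hends, ← hΨ, ← hρf]; rfl
  rw [this]
  exact (dSmooth_act (A'.isPlot_endpoint hη').dSmooth hρ).isPlot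

/-- A smooth map over the base that is compatible with horizontal transport intertwines the
connections. -/
theorem map_toFun_of_jointTransport
    {Ψ : E → E'} (hΨ : DSmooth Ψ) (hp : ∀ ξ, π' (Ψ ξ) = π ξ)
    (hT : ∀ p q : E × E', JointTransport A A' p q → p.2 = Ψ p.1 → q.2 = Ψ q.1)
    (α : SmoothPath E) (r : ℝ) (hr : r ∈ α.dom) :
    (A.toFun (α.init r hr)).map Ψ hΨ = A'.toFun ((α.map Ψ hΨ).init r hr) := by
  have hd := A.dom_eq α r hr
  have hd' := A'.dom_eq (α.map Ψ hΨ) r hr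
  refine SmoothPath.ext_of_dom (hd.trans hd'.symm) fun s hs hs' => ?_
  have hJ := JointTransport.of_isHorizontal
    (Connection.isHorizontal_toFun (A := A) α r hr)
    (Connection.isHorizontal_toFun (A := A') (α.map Ψ hΨ) r hr)
    (hd.trans hd'.symm) (fun s hs _ => (A.lifting α r hr s (hd ▸ hs)).trans
      ((hp _).symm.trans (A'.lifting (α.map Ψ hΨ) r hr s (hd ▸ hs)).symm))
    (s := r) (t := s) (hd.symm ▸ hr) hs
  refine (hT _ _ hJ ?_).symm
  rw [A.basepoint α r hr, A'.basepoint (α.map Ψ hΨ) r hr]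
  rfl

/-- If joint transport starting at `p` has the same holonomy in both bundles, then it defines an
equivariant map over the base. -/
theorem exists_equivariant_of_jointTransport (hX : IsPathConnected X)
    (hπ : IsPrincipalBundle G π) (hπ' : IsPrincipalBundle G π') {p : E × E'}
    (hp : π p.1 = π' p.2)
    (hhol : ∀ h h' : G, JointTransport A A' p (p.1 <• h, p.2 <• h') → h = h') :
    ∃ Ψ : E → E', ∀ e e',
      e' = Ψ e ↔ ∃ g : G, JointTransport A A' p (e <• g, e' <• g) := by
  have hex : ∀ e, ∃ (e' : E') (g : G), JointTransport A A' p (e <• g, e' <• g) := fun e => by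
    obtain ⟨q, hq, h⟩ := JointTransport.exists_of_isPathConnected hX hπ hπ' A A' hp (π e)
    obtain ⟨g, hg⟩ := hπ.exists_act_eq hq.symm
    refine ⟨q.2 <• g⁻¹, g, ?_⟩
    rwa [← smul_op_mul, inv_mul_cancel, smul_op_one, ← hg]
  choose Ψ g hΨ using hex
  refine ⟨Ψ, fun e e' => ⟨fun h => ⟨g e, h ▸ hΨ e⟩, ?_⟩⟩
  rintro ⟨k, hk⟩
  have hfib : π' (Ψ e <• g e) = π' (e' <• g e) := by
    rw [← (hΨ e).proj_eq_right, hπ.proj_act, hπ'.proj_act]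
    have := hk.proj_eq_right
    rwa [hπ.proj_act, hπ'.proj_act] at this
  obtain ⟨m, hm⟩ := hπ'.exists_act_eq hfib
  -- Translate the second transport so that it ends where the first one does. Going out along the
  -- first and back along this one is a loop whose two holonomies differ by m⁻¹, so `hhol` forces m
  -- = 1.
  have h1 := hk.act hπ hπ' (k⁻¹ * g e) (k⁻¹ * g e * m⁻¹)
  have e1 : (e <• k) <• (k⁻¹ * g e) = e <• g e := by
    rw [← smul_op_mul, mul_inv_cancel_left]
  have e2 : (e' <• k) <• (k⁻¹ * g e * m⁻¹) = Ψ e <• g e := by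
    rw [← smul_op_mul, mul_assoc, mul_inv_cancel_left, smul_op_mul, hm, ← smul_op_mul,
      mul_inv_cancel, smul_op_one]
  dsimp only at h1
  rw [e1, e2] at h1
  have h2 := hhol _ _ ((hΨ e).trans h1.symm)
  have hm1 : m = 1 := by simpa using h2
  rw [hm1, smul_op_one] at hm
  exact MulAction.injective (MulOpposite.op (g e)) hm

theorem exists_bundleIso_of_jointTransport [DiffeologicalGroup G] (hX : IsPathConnected X)
    (hπ : IsPrincipalBundle G π) (hπ' : IsPrincipalBundle G π') {p : E × E'}
    (hp : π p.1 = π' p.2)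
    (hhol : ∀ h h' : G, JointTransport A A' p (p.1 <• h, p.2 <• h') → h = h') :
    ∃ (Ψ : E → E') (hΨ : IsBundleIso G π π' Ψ), ∀ (α : SmoothPath E) (r : ℝ) (hr : r ∈ α.dom),
      (A.toFun (α.init r hr)).map Ψ hΨ.diffeo.1 =
        A'.toFun ((α.map Ψ hΨ.diffeo.1).init r hr) := by
  obtain ⟨Ψ, hΨ⟩ := exists_equivariant_of_jointTransport hX hπ hπ' hp hhol
  -- Exchanging the bundles transposes the graph, so `Θ` is the inverse of `Ψ` and its smoothness
  -- follows from the same lemma.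
  obtain ⟨Θ, hΘ⟩ := exists_equivariant_of_jointTransport (A := A') (A' := A) (p := p.swap)
    hX hπ' hπ hp.symm fun h h' hJ => (hhol h' h hJ.swap).symm
  have hΨΘ : ∀ e e', e' = Ψ e ↔ e = Θ e' := fun e e' => by
    rw [hΨ, hΘ]
    exact ⟨fun ⟨g, h⟩ => ⟨g, h.swap⟩, fun ⟨g, h⟩ => ⟨g, h.swap⟩⟩
  have hequiv : ∀ (ξ : E) (g : G), Ψ (ξ <• g) = Ψ ξ <• g := fun ξ g => by
    obtain ⟨k, hk⟩ := (hΨ ξ _).1 rfl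
    refine ((hΨ _ _).2 ⟨g⁻¹ * k, ?_⟩).symm
    rwa [← smul_op_mul, ← smul_op_mul, mul_inv_cancel_left]
  have hproj : ∀ ξ, π' (Ψ ξ) = π ξ := fun ξ => by
    obtain ⟨k, hk⟩ := (hΨ ξ _).1 rfl
    have := hk.proj_eq_right
    rw [hπ.proj_act, hπ'.proj_act] at this
    exact this.symm
  have htrans : ∀ q r : E × E', JointTransport A A' q r → q.2 = Ψ q.1 → r.2 = Ψ r.1 := by
    intro q r hqr hq
    obtain ⟨k, hk⟩ := (hΨ _ _).1 hq
    exact (hΨ _ _).2 ⟨k, hk.trans (hqr.act hπ hπ' k k)⟩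
  have hs : DSmooth Ψ := dSmooth_of_jointTransport hπ hπ' hequiv hproj htrans
  have hs' : DSmooth Θ := by
    refine dSmooth_of_jointTransport (A := A') (A' := A) hπ' hπ (fun ξ g => ?_) (fun ξ => ?_)
      fun q r hqr hq => ?_
    · refine ((hΨΘ _ _).1 ?_).symm
      rw [hequiv, ← (hΨΘ _ ξ).2 rfl]
    · rw [← hproj, ← (hΨΘ _ ξ).2 rfl]
    · exact (hΨΘ _ _).1 (htrans _ _ hqr.swap ((hΨΘ _ _).2 hq))
  exact ⟨Ψ, ⟨⟨hs, Θ, hs', fun e => ((hΨΘ e _).1 rfl).symm, fun e => ((hΨΘ _ e).2 rfl).symm⟩,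
    hequiv, hproj⟩, map_toFun_of_jointTransport hs hproj htrans⟩

end Iso

end DiffeologicalBundles

end

theorem mainTheorem4 {X G E E' : Type*} [DiffeologicalSpace X]
    [Group G] [DiffeologicalSpace G] [DiffeologicalBundles.DiffeologicalGroup G]
    [DiffeologicalSpace E] [MulAction Gᵐᵒᵖ E] [DiffeologicalBundles.SmoothRightAction G E]
    [DiffeologicalSpace E'] [MulAction Gᵐᵒᵖ E'] [DiffeologicalBundles.SmoothRightAction G E']
    (hX : DiffeologicalBundles.IsPathConnected X) (x₀ : X)
    (π : E → X) (hπ : DiffeologicalBundles.IsPrincipalBundle G π)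
    (π' : E' → X) (hπ' : DiffeologicalBundles.IsPrincipalBundle G π')
    (A : DiffeologicalBundles.Connection G π) (A' : DiffeologicalBundles.Connection G π')
    (ξ : E) (hξ : π ξ = x₀) (ξ' : E') (hξ' : π' ξ' = x₀)
    (hconj : ∃ g : G, ∀ γ : DiffeologicalBundles.SmoothLoop X x₀,
      A.holonomy x₀ ξ γ = g * A'.holonomy x₀ ξ' γ * g⁻¹) :
    ∃ (Ψ : E → E') (hΨ : DiffeologicalBundles.IsBundleIso G π π' Ψ),
      ∀ (α : DiffeologicalBundles.SmoothPath E) (r : ℝ) (hr : r ∈ α.dom),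
        (A.toFun (α.init r hr)).map Ψ hΨ.diffeo.1 =
          A'.toFun ((α.map Ψ hΨ.diffeo.1).init r hr) := by

  obtain ⟨g, hg⟩ := hconj
  -- Starting at ξg absorbs the conjugation: translating back by g⁻¹ in E gives a loop with
  -- holonomies g h g⁻¹ at ξ and h' at ξ', so the hypothesis yields h = h'.
  refine DiffeologicalBundles.exists_bundleIso_of_jointTransport (p := (ξ <• g, ξ')) hX hπ hπ'
    ((hπ.proj_act ξ g).trans (hξ.trans hξ'.symm)) fun h h' hJ => ?_
  have hJ' := hJ.act hπ hπ' g⁻¹ 1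
  simp only [← DiffeologicalBundles.smul_op_mul, DiffeologicalBundles.smul_op_one,
    mul_inv_cancel] at hJ'
  obtain ⟨γ, h1, h2⟩ := hJ'.holonomy_eq hπ hπ' hξ
  have h3 := hg γ
  rw [h1, h2] at h3
  simpa using h3
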